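/- A cylindric partition with profile $c=(c_1,\dots,c_r)$ is an $r$-tuple $\Lambda=(\lambda^{(1)},\dots,\lambda^{(r)})$ of ordinary partitions (finite non-increasing sequences of positive integers, possibly empty, extended by zeros) such that $\lambda^{(i)}_j\ge\lambda^{(i+1)}_{j+c_{i+1}}$ for $1\le i<r$ and $\lambda^{(r)}_j\ge\lambda^{(1)}_{j+c_1}$, for all $j\ge1$. Its size $|\Lambda|$ is the sum of all the parts of $\lambda^{(1)},\dots,\lambda^{(r)}$. For $a,q\in\mathbb{C}$ with $|q|<1$ write $(a;q)_n=\prod_{k=1}^{n}(1-aq^{k-1})$ and $(a;q)_\infty=\lim_{n\to\infty}(a;q)_n$. Let $P_{(2,2)}$ be the set of all cylindric partitions with profile $c=(2,2)$. Then for every $q\in\mathbb{C}$ with $|q|<1$ the series below converge absolutely and $$\sum_{\Lambda\in P_{(2,2)}} q^{|\Lambda|}=\left(1+\sum_{n\ge1}\frac{2\,q^{n(n+1)}\,(-q^2;q^2)_{n-1}}{(q^2;q^2)_n\,(-q;q^2)_n}\right)\cdot\frac{(-q;q^2)_\infty}{(q;q)_\infty}.$$ -/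

import Mathlib

open Filter Topology

/-- A cylindric partition of rank `r` with profile `c = (c₁, …, c_r)` (here indexed by `Fin r`,
starting from `0`).  An ordinary partition is a weakly decreasing sequence of natural numbers
with finitely many nonzero terms, its parts being the nonzero terms.  In the interlacing
condition `λ_j^{(i)} ≥ λ_{j + c_{i+1}}^{(i+1)}` the index `i + 1` is taken cyclically in `Fin r`,
so that the case of the last row reads `λ_j^{(r)} ≥ λ_{j + c₁}^{(1)}`. -/
@[ext]
structure CylindricPartition {r : ℕ} [NeZero r] (c : Fin r → ℕ) where
  /-- The `i`-th ordinary partition, padded with zeros. -/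
  row : Fin r → ℕ →₀ ℕ
  row_antitone : ∀ i, Antitone (row i)
  interlace : ∀ (i : Fin r) (j : ℕ), row (i + 1) (j + c (i + 1)) ≤ row i j

/-- The size `|Λ|`: the sum of all the parts of all the ordinary partitions in `Λ`. -/
def CylindricPartition.size {r : ℕ} [NeZero r] {c : Fin r → ℕ} (Λ : CylindricPartition c) : ℕ :=
  ∑ i, (Λ.row i).sum fun _ part => part

/-- The finite `q`-Pochhammer symbol `(a; q)_n = ∏_{k=1}^{n} (1 - a q^{k-1})`. -/
def qPoch (a q : ℂ) (n : ℕ) : ℂ := ∏ k ∈ Finset.range n, (1 - a * q ^ k)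

/-- The infinite `q`-Pochhammer symbol `(a; q)_∞`, for `|q| < 1`. -/
noncomputable def qPochInf (a q : ℂ) : ℂ := ∏' k : ℕ, (1 - a * q ^ k)

/-- For `|q| < 1`, `(a; q)_∞` is the limit of `(a; q)_n` as `n → ∞`. -/
theorem tendsto_qPoch (a : ℂ) {q : ℂ} (hq : ‖q‖ < 1) :
    Tendsto (qPoch a q) atTop (𝓝 (qPochInf a q)) := by
  have hs : Summable fun k : ℕ => ‖-(a * q ^ k)‖ := by
    simp only [norm_neg, norm_mul, norm_pow]
    exact (summable_geometric_of_lt_one (norm_nonneg q) hq).mul_left _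
  have hm := (multipliable_one_add_of_summable hs).tendsto_prod_tprod_nat
  simp only [← sub_eq_add_neg] at hm
  exact hm

/-! Let `F(a, b)` be the generating function of the pairs whose rows have at most `a` and `b` parts.
If `|a - b| ≤ 2`, adding a full column maps these pairs bijectively onto those with exactly `a` and
`b` parts. Inclusion-exclusion then gives recurrences (`boundedGF_succ_succ`, `boundedGF_add_two`).
For `x_n = (q;q)_{2n} F(n, n)` and `y_n = (q;q)_{2n+1} F(n+1, n)` they become a first-order linear
system (`evenGF_succ`, `oddGF_succ`), and both sequences tend to the desired sum times `(q;q)_∞`.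

The series `A_m` (`tailSeries`) solves the adjoint second-order recurrence and tends to `1`. Hence
`A_m y_m + (1 - q^(2m+1)) A_{m+1} (y_m - x_m)` does not depend on `m` (`tailSeries_invariant`). It
equals `A_0` at `m = 0` and the sum times `(q;q)_∞` in the limit; `A_0` is the right-hand series
times `(-q;q²)_∞`.

Absolute convergence comes from the same system over `ℝ`, where it bounds `F(n, n)` uniformly. -/

/-! ### Non-vanishing of `q`-Pochhammer symbols -/

theorem norm_mul_pow_lt_one {a q : ℂ} (ha : ‖a‖ < 1) (hq : ‖q‖ < 1) (k : ℕ) :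
    ‖a * q ^ k‖ < 1 := by
  rw [norm_mul, norm_pow]
  exact (mul_le_of_le_one_right (norm_nonneg a)
    (pow_le_one₀ (norm_nonneg q) hq.le)).trans_lt ha

theorem one_sub_ne_zero_of_norm_lt_one {a : ℂ} (ha : ‖a‖ < 1) : 1 - a ≠ 0 := by
  intro h
  rw [← sub_eq_zero.mp h, norm_one] at ha
  exact lt_irrefl _ ha

theorem norm_sq_lt_one {q : ℂ} (hq : ‖q‖ < 1) : ‖q ^ 2‖ < 1 := by
  rw [norm_pow]
  exact pow_lt_one₀ (norm_nonneg q) hq two_ne_zero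

theorem qPoch_zero (a q : ℂ) : qPoch a q 0 = 1 := by simp [qPoch]

theorem qPoch_succ (a q : ℂ) (n : ℕ) : qPoch a q (n + 1) = qPoch a q n * (1 - a * q ^ n) :=
  Finset.prod_range_succ _ _

theorem qPoch_succ' (a q : ℂ) (n : ℕ) : qPoch a q (n + 1) = (1 - a) * qPoch (a * q) q n := by
  simp only [qPoch, Finset.prod_range_succ', pow_zero, mul_one, pow_succ']
  rw [mul_comm]
  simp only [mul_assoc]

theorem qPoch_ne_zero {a q : ℂ} (ha : ‖a‖ < 1) (hq : ‖q‖ < 1) (n : ℕ) : qPoch a q n ≠ 0 :=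
  Finset.prod_ne_zero_iff.mpr fun k _ =>
    one_sub_ne_zero_of_norm_lt_one (norm_mul_pow_lt_one ha hq k)

theorem qPochInf_ne_zero {a q : ℂ} (ha : ‖a‖ < 1) (hq : ‖q‖ < 1) : qPochInf a q ≠ 0 := by
  have hs : Summable fun k : ℕ => ‖-(a * q ^ k)‖ := by
    simp only [norm_neg, norm_mul, norm_pow]
    exact (summable_geometric_of_lt_one (norm_nonneg q) hq).mul_left _
  have h := tprod_one_add_ne_zero_of_summable (f := fun k : ℕ => -(a * q ^ k)) (fun k => by
    rw [← sub_eq_add_neg]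
    exact one_sub_ne_zero_of_norm_lt_one (norm_mul_pow_lt_one ha hq k)) hs
  simp only [← sub_eq_add_neg] at h
  exact h

/-! ### The auxiliary series and its recurrence -/

/-- The tail `(-q^{2k+1}; q²)_∞ = (-q; q²)_∞ / (-q; q²)_k`. -/
noncomputable def oddTail (q : ℂ) (k : ℕ) : ℂ := qPochInf (-q) (q ^ 2) / qPoch (-q) (q ^ 2) k

/-- The coefficient `q^{n(n+1)} (-1; q²)_n / (q²; q²)_n`. -/
noncomputable def gammaCoeff (q : ℂ) (n : ℕ) : ℂ :=
  q ^ (n * (n + 1)) * qPoch (-1) (q ^ 2) n / qPoch (q ^ 2) (q ^ 2) n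

/-- The `n`-th term of the series `tailSeries q m`. -/
noncomputable def tailTerm (q : ℂ) (m n : ℕ) : ℂ :=
  q ^ (2 * m * n) * gammaCoeff q n * oddTail q (m + n)

/-- The series `∑ₙ q^{2mn} q^{n(n+1)} (-1; q²)_n (-q^{2m+2n+1}; q²)_∞ / (q²; q²)_n`. -/
noncomputable def tailSeries (q : ℂ) (m : ℕ) : ℂ := ∑' n, tailTerm q m n

section

variable {q : ℂ} (hq : ‖q‖ < 1)
include hq

theorem oddTail_eq (k : ℕ) : oddTail q k = (1 + q ^ (2 * k + 1)) * oddTail q (k + 1) := by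
  have hq2 := norm_sq_lt_one hq
  have hn : ‖-q‖ < 1 := by rwa [norm_neg]
  have h1 := qPoch_ne_zero hn hq2 k
  have h2 := qPoch_ne_zero hn hq2 (k + 1)
  have h3 : 1 + q ^ (2 * k + 1) ≠ 0 := by
    rw [qPoch_succ] at h2
    have := right_ne_zero_of_mul h2
    convert this using 1
    ring
  rw [oddTail, oddTail, qPoch_succ, show 1 - -q * (q ^ 2) ^ k = 1 + q ^ (2 * k + 1) by ring]
  field_simp

theorem tendsto_oddTail : Tendsto (oddTail q) atTop (𝓝 1) := by
  have hq2 := norm_sq_lt_one hq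
  have hn : ‖-q‖ < 1 := by rwa [norm_neg]
  have h := (tendsto_const_nhds (x := qPochInf (-q) (q ^ 2))).div (tendsto_qPoch (-q) hq2)
    (qPochInf_ne_zero hn hq2)
  rwa [div_self (qPochInf_ne_zero hn hq2)] at h

theorem gammaCoeff_succ (n : ℕ) : gammaCoeff q (n + 1) * (1 - q ^ (2 * n + 2)) =
    gammaCoeff q n * (q ^ (2 * n + 2) * (1 + q ^ (2 * n))) := by
  have hq2 := norm_sq_lt_one hq
  have h1 := qPoch_ne_zero hq2 hq2 n
  have h2 := qPoch_ne_zero hq2 hq2 (n + 1)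
  have h3 : 1 - q ^ (2 * n + 2) ≠ 0 := by
    rw [qPoch_succ] at h2
    have := right_ne_zero_of_mul h2
    convert this using 1
    ring
  rw [gammaCoeff, gammaCoeff, qPoch_succ, qPoch_succ,
    show 1 - q ^ 2 * (q ^ 2) ^ n = 1 - q ^ (2 * n + 2) by ring,
    show 1 - -1 * (q ^ 2) ^ n = 1 + q ^ (2 * n) by ring]
  field_simp
  ring

theorem summable_norm_gammaCoeff : Summable fun n => ‖gammaCoeff q n‖ := by
  have hq0 : Tendsto (fun n : ℕ => q ^ (2 * n)) atTop (𝓝 0) := by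
    simpa only [pow_mul] using tendsto_pow_atTop_nhds_zero_of_norm_lt_one (norm_sq_lt_one hq)
  have hl : Tendsto (fun n : ℕ => q ^ (2 * n) * q ^ 2 * (1 + q ^ (2 * n)) /
      (1 - q ^ (2 * n) * q ^ 2)) atTop (𝓝 (0 * q ^ 2 * (1 + 0) / (1 - 0 * q ^ 2))) :=
    ((hq0.mul_const _).mul (hq0.const_add 1)).div ((hq0.mul_const _).const_sub 1) (by simp)
  have hl' := hl.norm
  simp only [zero_mul, zero_div, norm_zero] at hl'
  -- The ratio of consecutive coefficients tends to `0`, so any constant in `(0, 1)` would serve.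
  refine summable_of_ratio_norm_eventually_le (r := 1 / 2) (by norm_num) ?_
  filter_upwards [hl'.eventually (ge_mem_nhds (show (0 : ℝ) < 1 / 2 by norm_num))] with n hn
  have hne : 1 - q ^ (2 * n) * q ^ 2 ≠ 0 := by
    rw [← pow_add]
    apply one_sub_ne_zero_of_norm_lt_one
    rw [norm_pow]
    exact pow_lt_one₀ (norm_nonneg q) hq (by omega)
  have h := gammaCoeff_succ hq n
  have : gammaCoeff q (n + 1) = q ^ (2 * n) * q ^ 2 * (1 + q ^ (2 * n)) /
      (1 - q ^ (2 * n) * q ^ 2) * gammaCoeff q n := by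
    rw [div_mul_eq_mul_div, eq_div_iff hne, ← pow_add, h]
    ring
  rw [this, norm_norm, norm_norm, norm_mul]
  exact mul_le_mul_of_nonneg_right hn (norm_nonneg _)

theorem exists_norm_oddTail_le : ∃ C, ∀ k, ‖oddTail q k‖ ≤ C := by
  obtain ⟨C, hC⟩ := (tendsto_oddTail hq).norm.bddAbove_range
  exact ⟨C, fun k => hC ⟨k, rfl⟩⟩

theorem exists_norm_tailTerm_le : ∃ C, ∀ m n, ‖tailTerm q m n‖ ≤ C * ‖gammaCoeff q n‖ := by
  obtain ⟨C, hC⟩ := exists_norm_oddTail_le hq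
  refine ⟨C, fun m n => ?_⟩
  rw [tailTerm, norm_mul, norm_mul, norm_pow, mul_comm C]
  have h1 : ‖q‖ ^ (2 * m * n) ≤ 1 := pow_le_one₀ (norm_nonneg q) hq.le
  exact mul_le_mul (mul_le_of_le_one_left (norm_nonneg _) h1) (hC _) (norm_nonneg _)
    (norm_nonneg _)

theorem summable_tailTerm (m : ℕ) : Summable (tailTerm q m) := by
  obtain ⟨C, hC⟩ := exists_norm_tailTerm_le hq
  exact Summable.of_norm_bounded ((summable_norm_gammaCoeff hq).mul_left C) (hC m)

/-- Certificate for `tailSeries_recurrence`: the right side is `t_n - t_{n+1}`, where `t_0 = 0`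
through the factor `1 - q^(2n)` and `t_n → 0`. -/
theorem tailTerm_telescope (m n : ℕ) :
    tailTerm q m n - (1 + q ^ (2 * m + 1) + q ^ (2 * m + 2)) * tailTerm q (m + 1) n -
        q ^ (2 * m + 2) * (1 - q ^ (2 * m + 3)) * tailTerm q (m + 2) n =
      q ^ (2 * m * n) * gammaCoeff q n * (1 - q ^ (2 * n)) * oddTail q (m + n + 1) -
        q ^ (2 * m * (n + 1)) * gammaCoeff q (n + 1) * (1 - q ^ (2 * (n + 1))) *
          oddTail q (m + (n + 1) + 1) := by
  have h0 := oddTail_eq hq (m + n)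
  have h1 := oddTail_eq hq (m + n + 1)
  have hg := gammaCoeff_succ hq n
  simp only [tailTerm]
  rw [show m + 1 + n = m + n + 1 by ring, show m + 2 + n = m + n + 1 + 1 by ring,
    show m + (n + 1) + 1 = m + n + 1 + 1 by ring, h0, h1,
    show q ^ (2 * m * (n + 1)) * gammaCoeff q (n + 1) * (1 - q ^ (2 * (n + 1))) =
      q ^ (2 * m * (n + 1)) * (gammaCoeff q (n + 1) * (1 - q ^ (2 * n + 2))) by ring, hg]
  ring

theorem tailSeries_recurrence (m : ℕ) :
    tailSeries q m = (1 + q ^ (2 * m + 1) + q ^ (2 * m + 2)) * tailSeries q (m + 1) +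
      q ^ (2 * m + 2) * (1 - q ^ (2 * m + 3)) * tailSeries q (m + 2) := by
  have hs := (((summable_tailTerm hq m).hasSum.sub
    ((summable_tailTerm hq (m + 1)).hasSum.mul_left (1 + q ^ (2 * m + 1) + q ^ (2 * m + 2)))).sub
    ((summable_tailTerm hq (m + 2)).hasSum.mul_left
      (q ^ (2 * m + 2) * (1 - q ^ (2 * m + 3))))).tendsto_sum_nat
  simp only [tailTerm_telescope hq] at hs
  rw [funext fun N => Finset.sum_range_sub' (fun n => q ^ (2 * m * n) * gammaCoeff q n *
    (1 - q ^ (2 * n)) * oddTail q (m + n + 1)) N] at hs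
  have hq0 : Tendsto (fun n : ℕ => q ^ (2 * n)) atTop (𝓝 0) := by
    simpa only [pow_mul] using tendsto_pow_atTop_nhds_zero_of_norm_lt_one (norm_sq_lt_one hq)
  have hz : Tendsto (fun n : ℕ => q ^ (2 * m * n) * gammaCoeff q n *
      (1 - q ^ (2 * n)) * oddTail q (m + n + 1)) atTop (𝓝 0) := by
    have h1 : Tendsto (fun n => q ^ (2 * m * n) * gammaCoeff q n) atTop (𝓝 0) := by
      refine (Summable.of_norm_bounded (summable_norm_gammaCoeff hq) fun n => ?_).tendsto_atTop_zero
      rw [norm_mul, norm_pow]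
      exact mul_le_of_le_one_left (norm_nonneg _) (pow_le_one₀ (norm_nonneg q) hq.le)
    have h2 : Tendsto (fun n => oddTail q (m + n + 1)) atTop (𝓝 1) :=
      (tendsto_oddTail hq).comp
        (tendsto_atTop_mono (fun n => show n ≤ m + n + 1 by omega) tendsto_id)
    simpa using (h1.mul (hq0.const_sub 1)).mul h2
  have h := tendsto_nhds_unique hs (hz.const_sub _)
  simp only [mul_zero, pow_zero, sub_self, zero_mul] at h
  simp only [tailSeries]
  linear_combination h

/-- Dominated convergence: the factor `q^(2mn)` kills every term but `n = 0`, which is `oddTail q m`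
and tends to `1`. -/
theorem tendsto_tailSeries : Tendsto (tailSeries q) atTop (𝓝 1) := by
  obtain ⟨C, hC⟩ := exists_norm_tailTerm_le hq
  have h := tendsto_tsum_of_dominated_convergence (𝓕 := atTop) (f := tailTerm q)
    (g := fun n => if n = 0 then 1 else 0)
    (bound := fun n => C * ‖gammaCoeff q n‖) ((summable_norm_gammaCoeff hq).mul_left C)
    (fun n => ?_) (Eventually.of_forall hC)
  · rwa [tsum_ite_eq] at h
  · have h2 : Tendsto (fun m => oddTail q (m + n)) atTop (𝓝 1) :=
      (tendsto_oddTail hq).comp (tendsto_add_atTop_nat n)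
    rcases Nat.eq_zero_or_pos n with rfl | hn
    · simpa [tailTerm, gammaCoeff, qPoch_zero] using h2
    · have h1 : Tendsto (fun m : ℕ => q ^ (2 * m * n)) atTop (𝓝 0) := by
        have : ‖q ^ (2 * n)‖ < 1 := by
          rw [norm_pow]
          exact pow_lt_one₀ (norm_nonneg q) hq (by omega)
        refine (tendsto_pow_atTop_nhds_zero_of_norm_lt_one this).congr fun m => ?_
        rw [← pow_mul]
        congr 1
        ring
      simpa [hn.ne', tailTerm] using (h1.mul_const (gammaCoeff q n)).mul h2

end

theorem tailTerm_zero_zero (q : ℂ) : tailTerm q 0 0 = qPochInf (-q) (q ^ 2) := by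
  simp [tailTerm, gammaCoeff, oddTail, qPoch_zero]

theorem tailTerm_zero_pnat (q : ℂ) (n : ℕ+) : tailTerm q 0 n =
    2 * q ^ ((n : ℕ) * ((n : ℕ) + 1)) * qPoch (-q ^ 2) (q ^ 2) ((n : ℕ) - 1) /
      (qPoch (q ^ 2) (q ^ 2) n * qPoch (-q) (q ^ 2) n) * qPochInf (-q) (q ^ 2) := by
  obtain ⟨k, hk⟩ := Nat.exists_eq_succ_of_ne_zero n.ne_zero
  -- Splitting off the first factor of `(-1; q²)_{k+1}` produces the `2` in the statement.
  have h := qPoch_succ' (-1) (q ^ 2) k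
  rw [neg_one_mul] at h
  rw [hk, Nat.succ_eq_add_one, Nat.add_sub_cancel, tailTerm, gammaCoeff, oddTail, h, zero_add]
  simp only [mul_zero, zero_mul, pow_zero, one_mul, div_eq_mul_inv, mul_inv]
  ring

theorem summable_series_pnat {q : ℂ} (hq : ‖q‖ < 1) : Summable (fun n : ℕ+ =>
    2 * q ^ ((n : ℕ) * ((n : ℕ) + 1)) * qPoch (-q ^ 2) (q ^ 2) ((n : ℕ) - 1) /
      (qPoch (q ^ 2) (q ^ 2) n * qPoch (-q) (q ^ 2) n)) := by
  have hP : qPochInf (-q) (q ^ 2) ≠ 0 :=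
    qPochInf_ne_zero (by rwa [norm_neg]) (norm_sq_lt_one hq)
  have h := (summable_tailTerm hq 0).comp_injective PNat.coe_injective
  refine (summable_mul_right_iff hP).mp (h.congr fun n => ?_)
  exact tailTerm_zero_pnat q n

theorem tailSeries_zero {q : ℂ} (hq : ‖q‖ < 1) : tailSeries q 0 =
    (1 + ∑' n : ℕ+,
      2 * q ^ ((n : ℕ) * ((n : ℕ) + 1)) * qPoch (-q ^ 2) (q ^ 2) ((n : ℕ) - 1) /
        (qPoch (q ^ 2) (q ^ 2) n * qPoch (-q) (q ^ 2) n)) * qPochInf (-q) (q ^ 2) := by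
  rw [add_mul, one_mul, ← tsum_mul_right, ← tsum_congr (tailTerm_zero_pnat q),
    ← tailTerm_zero_zero]
  rw [tailSeries, (summable_tailTerm hq 0).tsum_eq_zero_add,
    tsum_pnat_eq_tsum_succ (f := tailTerm q 0)]

/-! ### Column addition and the combinatorics of profile `(2, 2)` -/

namespace CylindricPartition

/-- The cylindric partitions with profile `(2, 2)` whose rows have at most `a` and `b` parts. -/
def bounded (a b : ℕ) : Set (CylindricPartition ![2, 2]) := {Λ | Λ.row 0 a = 0 ∧ Λ.row 1 b = 0}

/-- The elements of `bounded a b` whose rows have exactly `a` and `b` parts. -/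
def full (a b : ℕ) : Set (CylindricPartition ![2, 2]) :=
  {Λ | Λ ∈ bounded a b ∧ (∀ j < a, Λ.row 0 j ≠ 0) ∧ ∀ j < b, Λ.row 1 j ≠ 0}

theorem interlace_zero (Λ : CylindricPartition ![2, 2]) (j : ℕ) :
    Λ.row 1 (j + 2) ≤ Λ.row 0 j := Λ.interlace 0 j

theorem interlace_one (Λ : CylindricPartition ![2, 2]) (j : ℕ) :
    Λ.row 0 (j + 2) ≤ Λ.row 1 j := Λ.interlace 1 j

theorem row_eq_zero {Λ : CylindricPartition ![2, 2]} {i : Fin 2} {a j : ℕ}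
    (h : Λ.row i a = 0) (hj : a ≤ j) : Λ.row i j = 0 :=
  Nat.eq_zero_of_le_zero ((Λ.row_antitone i hj).trans_eq h)

theorem row_ne_zero {Λ : CylindricPartition ![2, 2]} {i : Fin 2} {a j : ℕ}
    (h : Λ.row i a ≠ 0) (hj : j ≤ a) : Λ.row i j ≠ 0 := fun h0 => h (row_eq_zero h0 hj)

/-- The cylindric partition with profile `(2, 2)` and the given two rows. -/
def ofRows (f g : ℕ →₀ ℕ) (hf : Antitone f) (hg : Antitone g) (hgf : ∀ j, g (j + 2) ≤ f j)
    (hfg : ∀ j, f (j + 2) ≤ g j) : CylindricPartition ![2, 2] where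
  row := ![f, g]
  row_antitone := Fin.forall_fin_two.mpr ⟨hf, hg⟩
  interlace := Fin.forall_fin_two.mpr ⟨hgf, hfg⟩

theorem ext_rows {Λ M : CylindricPartition ![2, 2]} (h0 : ∀ j, Λ.row 0 j = M.row 0 j)
    (h1 : ∀ j, Λ.row 1 j = M.row 1 j) : Λ = M :=
  CylindricPartition.ext (funext (Fin.forall_fin_two.mpr ⟨Finsupp.ext h0, Finsupp.ext h1⟩))

theorem size_eq {Λ : CylindricPartition ![2, 2]} {a b : ℕ} (h : Λ ∈ bounded a b) :
    Λ.size = ∑ j ∈ Finset.range a, Λ.row 0 j + ∑ j ∈ Finset.range b, Λ.row 1 j := by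
  have key : ∀ (i : Fin 2) (c : ℕ), Λ.row i c = 0 →
      ((Λ.row i).sum fun _ part => part) = ∑ j ∈ Finset.range c, Λ.row i j := by
    intro i c hc
    refine Finsupp.sum_of_support_subset _ (fun j hj => ?_) _ fun _ _ => rfl
    rw [Finset.mem_range]
    by_contra! hcj
    exact Finsupp.mem_support_iff.mp hj (row_eq_zero hc hcj)
  rw [size, Fin.sum_univ_two, key 0 a h.1, key 1 b h.2]

/-- The partition with `a` parts, all equal to `1`. -/
noncomputable def column (a : ℕ) : ℕ →₀ ℕ :=
  Finsupp.onFinset (Finset.range a) (fun j => if j < a then 1 else 0) (by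
    intro j hj
    simpa using hj)

theorem column_apply (a j : ℕ) : column a j = if j < a then 1 else 0 := rfl

theorem bounded_mono {a b a' b' : ℕ} (ha : a ≤ a') (hb : b ≤ b') : bounded a b ⊆ bounded a' b' :=
  fun _ h => ⟨row_eq_zero h.1 ha, row_eq_zero h.2 hb⟩

/-- Increase the first `a` parts of the first row and the first `b` parts of the second row. -/
noncomputable def addColumn {a b : ℕ} (hab : a ≤ b + 2) (hba : b ≤ a + 2) (Λ : bounded a b) :
    CylindricPartition ![2, 2] :=
  ofRows (Λ.1.row 0 + column a) (Λ.1.row 1 + column b)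
    (fun i j hij => by
      have := Λ.1.row_antitone 0 hij
      simp only [Finsupp.add_apply, column_apply]
      split_ifs <;> omega)
    (fun i j hij => by
      have := Λ.1.row_antitone 1 hij
      simp only [Finsupp.add_apply, column_apply]
      split_ifs <;> omega)
    (fun j => by
      have h1 := Λ.1.interlace_zero j
      simp only [Finsupp.add_apply, column_apply]
      split_ifs <;> omega)
    (fun j => by
      have h1 := Λ.1.interlace_one j
      simp only [Finsupp.add_apply, column_apply]
      split_ifs <;> omega)

section AddColumn

variable {a b : ℕ} (hab : a ≤ b + 2) (hba : b ≤ a + 2)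

theorem addColumn_row_zero (Λ : bounded a b) (j : ℕ) :
    (addColumn hab hba Λ).row 0 j = Λ.1.row 0 j + if j < a then 1 else 0 := rfl

theorem addColumn_row_one (Λ : bounded a b) (j : ℕ) :
    (addColumn hab hba Λ).row 1 j = Λ.1.row 1 j + if j < b then 1 else 0 := rfl

theorem addColumn_mem_full (Λ : bounded a b) : addColumn hab hba Λ ∈ full a b := by
  refine ⟨⟨?_, ?_⟩, fun j hj => ?_, fun j hj => ?_⟩
  · simp [addColumn_row_zero, Λ.2.1]
  · simp [addColumn_row_one, Λ.2.2]
  · simp [addColumn_row_zero, hj]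
  · simp [addColumn_row_one, hj]

theorem size_addColumn (Λ : bounded a b) : (addColumn hab hba Λ).size = a + b + Λ.1.size := by
  rw [size_eq (addColumn_mem_full hab hba Λ).1, size_eq Λ.2]
  simp only [addColumn_row_zero, addColumn_row_one, Finset.sum_add_distrib]
  have h : ∀ c, ∑ j ∈ Finset.range c, (if j < c then 1 else 0) = c := fun c => by
    rw [Finset.sum_congr rfl fun j hj => if_pos (Finset.mem_range.mp hj)]
    simp
  rw [h, h]
  ring

theorem addColumn_injective : Function.Injective (addColumn hab hba) := by
  intro Λ M h
  refine Subtype.ext (ext_rows (fun j => ?_) fun j => ?_)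
  · have := addColumn_row_zero hab hba Λ j
    rw [h, addColumn_row_zero] at this
    omega
  · have := addColumn_row_one hab hba Λ j
    rw [h, addColumn_row_one] at this
    omega

/-- Removing the column is the inverse. Interlacing survives: where only the larger entry loses `1`,
the smaller one lies past the end of its row and is `0`. -/
theorem range_addColumn : Set.range (addColumn hab hba) = full a b := by
  refine Set.Subset.antisymm (Set.range_subset_iff.mpr (addColumn_mem_full hab hba)) ?_
  rintro Λ ⟨⟨ha, hb⟩, h0, h1⟩
  have hz0 : ∀ j, a ≤ j → Λ.row 0 j = 0 := fun j => row_eq_zero ha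
  have hz1 : ∀ j, b ≤ j → Λ.row 1 j = 0 := fun j => row_eq_zero hb
  refine ⟨⟨ofRows (Λ.row 0 - column a) (Λ.row 1 - column b) (fun i j hij => ?_)
    (fun i j hij => ?_) (fun j => ?_) fun j => ?_, ?_, ?_⟩, ?_⟩
  · have := Λ.row_antitone 0 hij
    have := hz0 j
    simp only [Finsupp.tsub_apply, column_apply]
    split_ifs <;> omega
  · have := Λ.row_antitone 1 hij
    have := hz1 j
    simp only [Finsupp.tsub_apply, column_apply]
    split_ifs <;> omega
  · have := Λ.interlace_zero j
    have := hz1 (j + 2)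
    simp only [Finsupp.tsub_apply, column_apply]
    split_ifs <;> omega
  · have := Λ.interlace_one j
    have := hz0 (j + 2)
    simp only [Finsupp.tsub_apply, column_apply]
    split_ifs <;> omega
  · change Λ.row 0 a - _ = 0
    rw [ha, Nat.zero_sub]
  · change Λ.row 1 b - _ = 0
    rw [hb, Nat.zero_sub]
  · refine ext_rows (fun j => ?_) fun j => ?_
    · change Λ.row 0 j - (if j < a then 1 else 0) + (if j < a then 1 else 0) = Λ.row 0 j
      have := h0 j
      split_ifs <;> omega
    · change Λ.row 1 j - (if j < b then 1 else 0) + (if j < b then 1 else 0) = Λ.row 1 j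
      have := h1 j
      split_ifs <;> omega

end AddColumn

/-- The cylindric partition with the two rows exchanged. -/
def swap (Λ : CylindricPartition ![2, 2]) : CylindricPartition ![2, 2] :=
  ofRows (Λ.row 1) (Λ.row 0) (Λ.row_antitone 1) (Λ.row_antitone 0) Λ.interlace_one Λ.interlace_zero

theorem size_swap (Λ : CylindricPartition ![2, 2]) : Λ.swap.size = Λ.size := by
  rw [size, size, Fin.sum_univ_two, Fin.sum_univ_two, add_comm]
  rfl

/-- Exchanging the rows, as a bijection. -/
def swapEquiv (a b : ℕ) : bounded a b ≃ bounded b a where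
  toFun Λ := ⟨Λ.1.swap, Λ.2.2, Λ.2.1⟩
  invFun Λ := ⟨Λ.1.swap, Λ.2.2, Λ.2.1⟩
  left_inv _ := Subtype.ext (ext_rows (fun _ => rfl) fun _ => rfl)
  right_inv _ := Subtype.ext (ext_rows (fun _ => rfl) fun _ => rfl)

theorem exists_mem_bounded (Λ : CylindricPartition ![2, 2]) : ∃ n, Λ ∈ bounded n n := by
  have h : ∀ i, ∃ n, Λ.row i n = 0 := fun i => by
    obtain ⟨n, hn⟩ := Infinite.exists_notMem_finset (Λ.row i).support
    exact ⟨n, Finsupp.notMem_support_iff.mp hn⟩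
  obtain ⟨m, hm⟩ := h 0
  obtain ⟨n, hn⟩ := h 1
  exact ⟨max m n, row_eq_zero hm (le_max_left _ _), row_eq_zero hn (le_max_right _ _)⟩

theorem bounded_zero_zero (Λ : bounded 0 0) : Λ.1.size = 0 := by
  rw [size_eq Λ.2]
  simp

instance : Unique (bounded 0 0) where
  default := ⟨ofRows 0 0 (fun _ _ _ => le_rfl) (fun _ _ _ => le_rfl) (fun _ => le_rfl)
    fun _ => le_rfl, rfl, rfl⟩
  uniq Λ := Subtype.ext (ext_rows (fun j => row_eq_zero Λ.2.1 (Nat.zero_le j))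
    fun j => row_eq_zero Λ.2.2 (Nat.zero_le j))

theorem mem_full_succ_succ {Λ : CylindricPartition ![2, 2]} {a b : ℕ} :
    Λ ∈ full (a + 1) (b + 1) ↔
      Λ ∈ bounded (a + 1) (b + 1) ∧ Λ ∉ bounded a (b + 1) ∧ Λ ∉ bounded (a + 1) b := by
  constructor
  · rintro ⟨h, h0, h1⟩
    exact ⟨h, fun h' => h0 a a.lt_succ_self h'.1, fun h' => h1 b b.lt_succ_self h'.2⟩
  · rintro ⟨h, h0, h1⟩
    exact ⟨h, fun j hj => row_ne_zero (fun h' => h0 ⟨h', h.2⟩) (Nat.le_of_lt_succ hj),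
      fun j hj => row_ne_zero (fun h' => h1 ⟨h.1, h'⟩) (Nat.le_of_lt_succ hj)⟩

/-- Interlacing gives `Λ.row 0 (j + 2) ≤ Λ.row 1 j`, so `a + 2` parts in the first row force `a`
parts in the second. -/
theorem mem_full_add_two {Λ : CylindricPartition ![2, 2]} {a : ℕ} :
    Λ ∈ full (a + 2) a ↔ Λ ∈ bounded (a + 2) a ∧ Λ ∉ bounded (a + 1) a := by
  constructor
  · rintro ⟨h, h0, h1⟩
    exact ⟨h, fun h' => h0 (a + 1) (Nat.lt_succ_self _) h'.1⟩
  · rintro ⟨h, h0⟩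
    have h2 : Λ.row 0 (a + 1) ≠ 0 := fun h' => h0 ⟨h', h.2⟩
    refine ⟨h, fun j hj => row_ne_zero h2 (Nat.le_of_lt_succ hj), fun j hj h3 => ?_⟩
    have h4 := Λ.interlace_one j
    rw [h3] at h4
    exact row_ne_zero h2 (show j + 2 ≤ a + 1 by omega) (Nat.eq_zero_of_le_zero h4)

theorem mem_full_one_zero {Λ : CylindricPartition ![2, 2]} :
    Λ ∈ full 1 0 ↔ Λ ∈ bounded 1 0 ∧ Λ ∉ bounded 0 0 := by
  constructor
  · rintro ⟨h, h0, h1⟩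
    exact ⟨h, fun h' => h0 0 Nat.zero_lt_one h'.1⟩
  · rintro ⟨h, h0⟩
    refine ⟨h, fun j hj => ?_, fun j hj => absurd hj (Nat.not_lt_zero j)⟩
    obtain rfl : j = 0 := by omega
    exact fun h' => h0 ⟨h', h.2⟩

end CylindricPartition

/-! ### Generating functions and their recurrences -/

theorem summable_pow_sum {r : ℝ} (h0 : 0 ≤ r) (h1 : r < 1) (n : ℕ) :
    Summable fun f : Fin n → ℕ => r ^ ∑ i, f i := by
  induction n with
  | zero => exact (hasSum_fintype _).summable
  | succ n ih =>
    rw [← (Fin.consEquiv fun _ => ℕ).summable_iff]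
    have h := (summable_geometric_of_lt_one h0 h1).mul_of_nonneg ih (fun _ => pow_nonneg h0 _)
      fun _ => pow_nonneg h0 _
    refine h.congr fun x => ?_
    simp [Fin.consEquiv, Fin.sum_univ_succ, pow_add]

/-- The Euler product `(q; q)_n`. -/
def eulerProd {𝕜 : Type*} [CommRing 𝕜] (q : 𝕜) (n : ℕ) : 𝕜 :=
  ∏ k ∈ Finset.range n, (1 - q ^ (k + 1))

theorem eulerProd_succ {𝕜 : Type*} [CommRing 𝕜] (q : 𝕜) (n : ℕ) :
    eulerProd q (n + 1) = eulerProd q n * (1 - q ^ (n + 1)) :=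
  Finset.prod_range_succ _ _

theorem eulerProd_eq_qPoch (q : ℂ) (n : ℕ) : eulerProd q n = qPoch q q n := by
  simp only [eulerProd, qPoch, pow_succ']

namespace CylindricPartition

variable {𝕜 : Type*} [NormedField 𝕜]

/-- The generating function of `bounded a b`. -/
noncomputable def boundedGF (q : 𝕜) (a b : ℕ) : 𝕜 := ∑' Λ : bounded a b, q ^ Λ.1.size

theorem boundedGF_swap (q : 𝕜) (a b : ℕ) : boundedGF q a b = boundedGF q b a := by
  rw [boundedGF, boundedGF, ← (swapEquiv a b).tsum_eq]
  exact tsum_congr fun Λ => by rw [← size_swap]; rfl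

theorem boundedGF_zero_zero (q : 𝕜) : boundedGF q 0 0 = 1 := by
  rw [boundedGF, tsum_fintype, Fintype.sum_unique, bounded_zero_zero, pow_zero]

/-- The generating function of `bounded n n`, times `(q; q)_{2n}`. -/
noncomputable def evenGF (q : 𝕜) (n : ℕ) : 𝕜 := boundedGF q n n * eulerProd q (2 * n)

/-- The generating function of `bounded (n + 1) n`, times `(q; q)_{2n+1}`. -/
noncomputable def oddGF (q : 𝕜) (n : ℕ) : 𝕜 := boundedGF q (n + 1) n * eulerProd q (2 * n + 1)

theorem evenGF_zero (q : 𝕜) : evenGF q 0 = 1 := by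
  simp [evenGF, boundedGF_zero_zero, eulerProd]

variable [CompleteSpace 𝕜]

theorem summable_bounded {q : 𝕜} (hq : ‖q‖ < 1) (a b : ℕ) :
    Summable fun Λ : bounded a b => q ^ Λ.1.size := by
  apply Summable.of_norm
  simp only [norm_pow]
  have h0 := norm_nonneg q
  have h := (summable_pow_sum h0 hq a).mul_of_nonneg (summable_pow_sum h0 hq b)
    (fun _ => pow_nonneg h0 _) fun _ => pow_nonneg h0 _
  let g : bounded a b → (Fin a → ℕ) × (Fin b → ℕ) :=
    fun Λ => (fun i => Λ.1.row 0 i, fun i => Λ.1.row 1 i)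
  have hg : Function.Injective g := by
    intro Λ M hΛM
    obtain ⟨h1, h2⟩ := Prod.mk.inj hΛM
    refine Subtype.ext (ext_rows (fun j => ?_) fun j => ?_)
    · rcases lt_or_ge j a with hj | hj
      · exact congrFun h1 ⟨j, hj⟩
      · rw [row_eq_zero Λ.2.1 hj, row_eq_zero M.2.1 hj]
    · rcases lt_or_ge j b with hj | hj
      · exact congrFun h2 ⟨j, hj⟩
      · rw [row_eq_zero Λ.2.2 hj, row_eq_zero M.2.2 hj]
  refine (h.comp_injective hg).congr fun Λ => ?_
  rw [size_eq Λ.2, pow_add, Finset.sum_range, Finset.sum_range]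
  rfl

theorem hasSum_bounded {q : 𝕜} (hq : ‖q‖ < 1) (a b : ℕ) :
    HasSum ((bounded a b).indicator fun Λ => q ^ Λ.size) (boundedGF q a b) :=
  hasSum_subtype_iff_indicator.mp (summable_bounded hq a b).hasSum

theorem hasSum_full {q : 𝕜} (hq : ‖q‖ < 1) {a b : ℕ} (hab : a ≤ b + 2) (hba : b ≤ a + 2) :
    HasSum ((full a b).indicator fun Λ => q ^ Λ.size) (q ^ (a + b) * boundedGF q a b) := by
  rw [← (addColumn_injective hab hba).hasSum_iff]
  · refine ((summable_bounded hq a b).hasSum.mul_left (q ^ (a + b))).congr_fun fun Λ => ?_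
    rw [Function.comp_apply, Set.indicator_of_mem (addColumn_mem_full hab hba Λ),
      size_addColumn, pow_add q (a + b)]
  · intro Λ hΛ
    rw [range_addColumn] at hΛ
    exact Set.indicator_of_notMem hΛ _

section

variable {q : 𝕜} (hq : ‖q‖ < 1)
include hq

/-- Inclusion-exclusion: a pair in `bounded (a + 1) (b + 1)` is full or lies in one of two smaller
sets, which intersect in `bounded a b`. -/
theorem boundedGF_succ_succ {a b : ℕ} (hab : a ≤ b + 2) (hba : b ≤ a + 2) :
    boundedGF q (a + 1) (b + 1) + boundedGF q a b =
      q ^ (a + b + 2) * boundedGF q (a + 1) (b + 1) + boundedGF q a (b + 1) +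
        boundedGF q (a + 1) b := by
  have h1 := (hasSum_bounded hq (a + 1) (b + 1)).add (hasSum_bounded hq a b)
  have h2 := ((hasSum_full hq (a := a + 1) (b := b + 1) (by omega) (by omega)).add
    (hasSum_bounded hq a (b + 1))).add (hasSum_bounded hq (a + 1) b)
  rw [show a + 1 + (b + 1) = a + b + 2 by ring] at h2
  refine h1.unique (h2.congr_fun fun Λ => ?_)
  have e1 : Λ ∈ bounded a b ↔ Λ ∈ bounded a (b + 1) ∧ Λ ∈ bounded (a + 1) b :=
    ⟨fun h => ⟨bounded_mono le_rfl b.le_succ h, bounded_mono a.le_succ le_rfl h⟩,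
      fun h => ⟨h.1.1, h.2.2⟩⟩
  have e2 : Λ ∈ bounded a (b + 1) → Λ ∈ bounded (a + 1) (b + 1) :=
    fun h => bounded_mono a.le_succ le_rfl h
  have e3 : Λ ∈ bounded (a + 1) b → Λ ∈ bounded (a + 1) (b + 1) :=
    fun h => bounded_mono le_rfl b.le_succ h
  by_cases h3 : Λ ∈ bounded a (b + 1) <;> by_cases h4 : Λ ∈ bounded (a + 1) b <;>
    by_cases h5 : Λ ∈ bounded (a + 1) (b + 1) <;>
    simp_all [Set.indicator, mem_full_succ_succ]

theorem boundedGF_add_two (a : ℕ) : boundedGF q (a + 2) a =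
    q ^ (2 * a + 2) * boundedGF q (a + 2) a + boundedGF q (a + 1) a := by
  have h2 := (hasSum_full hq (a := a + 2) (b := a) (by omega) (by omega)).add
    (hasSum_bounded hq (a + 1) a)
  rw [show a + 2 + a = 2 * a + 2 by ring] at h2
  have hs : bounded (a + 1) a ⊆ bounded (a + 2) a := bounded_mono (Nat.le_succ _) le_rfl
  refine (hasSum_bounded hq (a + 2) a).unique ?_
  convert h2 using 2 with Λ
  have := @hs Λ
  by_cases h3 : Λ ∈ bounded (a + 2) a <;> by_cases h4 : Λ ∈ bounded (a + 1) a <;>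
    simp_all [Set.indicator, mem_full_add_two]

theorem boundedGF_one_zero : boundedGF q 1 0 = q * boundedGF q 1 0 + 1 := by
  have h2 := (hasSum_full hq (a := 1) (b := 0) (by omega) (by omega)).add
    (hasSum_bounded hq 0 0)
  rw [boundedGF_zero_zero, add_zero, pow_one] at h2
  have hs : bounded 0 0 ⊆ bounded 1 0 := bounded_mono zero_le_one le_rfl
  refine (hasSum_bounded hq 1 0).unique ?_
  convert h2 using 2 with Λ
  have := @hs Λ
  by_cases h3 : Λ ∈ bounded 1 0 <;> by_cases h4 : Λ ∈ bounded 0 0 <;>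
    simp_all [Set.indicator, mem_full_one_zero]

theorem oddGF_zero : oddGF q 0 = 1 := by
  have h1 : eulerProd q 1 = 1 - q := by simp [eulerProd]
  rw [oddGF, mul_zero, zero_add, h1]
  linear_combination boundedGF_one_zero hq

theorem evenGF_succ (n : ℕ) :
    evenGF q (n + 1) = 2 * oddGF q n - (1 - q ^ (2 * n + 1)) * evenGF q n := by
  have h := boundedGF_succ_succ hq (a := n) (b := n) (by omega) (by omega)
  rw [boundedGF_swap q n (n + 1)] at h
  simp only [evenGF, oddGF, show 2 * (n + 1) = 2 * n + 1 + 1 by ring, eulerProd_succ]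
  linear_combination eulerProd q (2 * n) * (1 - q ^ (2 * n + 1)) * h

theorem oddGF_succ (n : ℕ) :
    oddGF q (n + 1) = evenGF q (n + 1) + q ^ (2 * n + 2) * oddGF q n := by
  have h := boundedGF_succ_succ hq (a := n + 1) (b := n) (by omega) (by omega)
  have h2 := boundedGF_add_two hq n
  simp only [evenGF, oddGF, show 2 * (n + 1) = 2 * n + 1 + 1 by ring, eulerProd_succ]
  linear_combination eulerProd q (2 * n) * (1 - q ^ (2 * n + 1)) * (1 - q ^ (2 * n + 2)) * h +
    eulerProd q (2 * n) * (1 - q ^ (2 * n + 1)) * h2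

end

end CylindricPartition

/-! ### Uniform bounds and absolute convergence -/

theorem eulerProd_pos {r : ℝ} (h0 : 0 ≤ r) (h1 : r < 1) (n : ℕ) : 0 < eulerProd r n :=
  Finset.prod_pos fun k _ => sub_pos.mpr (pow_lt_one₀ h0 h1 k.succ_ne_zero)

theorem exists_inv_eulerProd_le {r : ℝ} (h0 : 0 ≤ r) (h1 : r < 1) :
    ∃ C, ∀ n, (eulerProd r n)⁻¹ ≤ C := by
  -- The Euler products converge to a nonzero limit, so their inverses converge and are bounded.
  have hr : ‖(r : ℂ)‖ < 1 := by rwa [Complex.norm_real, Real.norm_of_nonneg h0]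
  obtain ⟨C, hC⟩ :=
    ((tendsto_qPoch (r : ℂ) hr).inv₀ (qPochInf_ne_zero hr hr)).norm.bddAbove_range
  refine ⟨C, fun n => ?_⟩
  have h := hC ⟨n, rfl⟩
  have e : qPoch (r : ℂ) r n = (eulerProd r n : ℝ) := by
    rw [← eulerProd_eq_qPoch]
    simp [eulerProd]
  simp only [e] at h
  rwa [norm_inv, Complex.norm_real, Real.norm_of_nonneg (eulerProd_pos h0 h1 n).le] at h

namespace CylindricPartition

section

variable {r : ℝ} (h0 : 0 ≤ r) (h1 : r < 1)
include h0 h1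

theorem evenGF_le_oddGF (n : ℕ) : 0 ≤ evenGF r n ∧ evenGF r n ≤ oddGF r n ∧
    oddGF r n - evenGF r n ≤ r ^ (2 * n) * oddGF r n := by
  have hr : ‖r‖ < 1 := by rwa [Real.norm_of_nonneg h0]
  induction n with
  | zero => norm_num [evenGF_zero, oddGF_zero hr]
  | succ n ih =>
    obtain ⟨ih0, ih1, ih2⟩ := ih
    have e1 := evenGF_succ hr n
    have e2 := oddGF_succ hr n
    have p1 := mul_nonneg (pow_nonneg h0 (2 * n + 1)) ih0
    have p2 := mul_nonneg (pow_nonneg h0 (2 * n + 2)) (ih0.trans ih1)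
    have e3 : oddGF r n ≤ oddGF r (n + 1) := by linarith
    have p3 := mul_le_mul_of_nonneg_left e3 (pow_nonneg h0 (2 * n + 2))
    rw [show 2 * (n + 1) = 2 * n + 2 by ring]
    exact ⟨by linarith, by linarith, by linarith⟩

/-- Here `y_{n+1} = y_n + (y_n - x_n) + r^(2n+1) x_n + r^(2n+2) y_n`; each of the last three terms
is at most `r^n y_n`. -/
theorem oddGF_succ_le (n : ℕ) : oddGF r (n + 1) ≤ (1 + 3 * r ^ n) * oddGF r n := by
  have hr : ‖r‖ < 1 := by rwa [Real.norm_of_nonneg h0]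
  obtain ⟨i0, i1, i2⟩ := evenGF_le_oddGF h0 h1 n
  have e1 := evenGF_succ hr n
  have e2 := oddGF_succ hr n
  have hy := i0.trans i1
  have p0 := mul_le_mul_of_nonneg_right
    (pow_le_pow_of_le_one h0 h1.le (show n ≤ 2 * n by omega)) hy
  have p1 := mul_le_mul (pow_le_pow_of_le_one h0 h1.le (show n ≤ 2 * n + 1 by omega)) i1 i0
    (pow_nonneg h0 n)
  have p2 := mul_le_mul_of_nonneg_right
    (pow_le_pow_of_le_one h0 h1.le (show n ≤ 2 * n + 2 by omega)) hy
  linarith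

theorem exists_oddGF_le : ∃ C, ∀ n, oddGF r n ≤ C := by
  have hr : ‖r‖ < 1 := by rwa [Real.norm_of_nonneg h0]
  have hs : Summable fun n : ℕ => 3 * r ^ n := (summable_geometric_of_lt_one h0 h1).mul_left 3
  have hp : ∀ n : ℕ, 0 ≤ 3 * r ^ n := fun n => mul_nonneg zero_le_three (pow_nonneg h0 n)
  refine ⟨Real.exp (∑' n : ℕ, 3 * r ^ n), fun n => ?_⟩
  have h : oddGF r n ≤ ∏ k ∈ Finset.range n, (1 + 3 * r ^ k) := by
    induction n with
    | zero => simp [oddGF_zero hr]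
    | succ n ih =>
      rw [Finset.prod_range_succ, mul_comm]
      exact (oddGF_succ_le h0 h1 n).trans
        (mul_le_mul_of_nonneg_left ih (add_nonneg zero_le_one (hp n)))
  exact (h.trans (Real.prod_one_add_le_exp_sum _ hp)).trans
    (Real.exp_le_exp.mpr (hs.sum_le_tsum _ fun k _ => hp k))

theorem exists_boundedGF_le : ∃ C, ∀ n, boundedGF r n n ≤ C := by
  obtain ⟨C, hC⟩ := exists_oddGF_le h0 h1
  obtain ⟨D, hD⟩ := exists_inv_eulerProd_le h0 h1
  refine ⟨C * D, fun n => ?_⟩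
  have hE := eulerProd_pos h0 h1 (2 * n)
  obtain ⟨i0, i1, -⟩ := evenGF_le_oddGF h0 h1 n
  rw [show boundedGF r n n = evenGF r n * (eulerProd r (2 * n))⁻¹ from
    (mul_inv_cancel_right₀ hE.ne' _).symm]
  exact mul_le_mul (i1.trans (hC n)) (hD _) (inv_nonneg.mpr hE.le) ((i0.trans i1).trans (hC n))

theorem summable_real_pow_size : Summable fun Λ : CylindricPartition ![2, 2] => r ^ Λ.size := by
  have hr : ‖r‖ < 1 := by rwa [Real.norm_of_nonneg h0]
  obtain ⟨C, hC⟩ := exists_boundedGF_le h0 h1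
  refine summable_of_sum_le (c := C) (fun Λ => pow_nonneg h0 _) fun u => ?_
  choose N hN using exists_mem_bounded
  -- A finite set of pairs lies in one `bounded N N`, so its partial sum is at most `boundedGF r N
  -- N`.
  have hu : ∀ Λ ∈ u, Λ ∈ bounded (u.sup N) (u.sup N) := fun Λ hΛ =>
    bounded_mono (Finset.le_sup hΛ) (Finset.le_sup hΛ) (hN Λ)
  have hs := hasSum_bounded hr (u.sup N) (u.sup N)
  rw [← Finset.sum_congr rfl fun Λ hΛ => Set.indicator_of_mem (hu Λ hΛ) fun Λ => r ^ Λ.size]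
  exact (sum_le_hasSum u (fun Λ _ => Set.indicator_nonneg (fun _ _ => pow_nonneg h0 _) Λ) hs).trans
    (hC _)

end

/-! ### Passage to the limit -/

theorem summable_norm_pow_size {q : ℂ} (hq : ‖q‖ < 1) :
    Summable fun Λ : CylindricPartition ![2, 2] => ‖q ^ Λ.size‖ := by
  simp only [norm_pow]
  exact summable_real_pow_size (norm_nonneg q) hq

theorem tendsto_boundedGF {q : ℂ} (hq : ‖q‖ < 1) {a b : ℕ → ℕ} (ha : ∀ n, n ≤ a n)
    (hb : ∀ n, n ≤ b n) : Tendsto (fun n => boundedGF q (a n) (b n)) atTop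
      (𝓝 (∑' Λ : CylindricPartition ![2, 2], q ^ Λ.size)) := by
  simp only [← (hasSum_bounded hq _ _).tsum_eq]
  refine tendsto_tsum_of_dominated_convergence (summable_norm_pow_size hq) (fun Λ => ?_)
    (Eventually.of_forall fun n Λ => norm_indicator_le_norm_self _ _)
  obtain ⟨N, hN⟩ := exists_mem_bounded Λ
  refine tendsto_const_nhds.congr' ?_
  filter_upwards [eventually_ge_atTop N] with n hn
  exact (Set.indicator_of_mem (bounded_mono (hn.trans (ha n)) (hn.trans (hb n)) hN)
    fun Λ => q ^ Λ.size).symm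

theorem tailSeries_invariant {q : ℂ} (hq : ‖q‖ < 1) (m : ℕ) :
    tailSeries q m * oddGF q m +
      (1 - q ^ (2 * m + 1)) * tailSeries q (m + 1) * (oddGF q m - evenGF q m) =
        tailSeries q 0 := by
  induction m with
  | zero => simp [oddGF_zero hq, evenGF_zero]
  | succ m ih =>
    rw [← ih, tailSeries_recurrence hq m, oddGF_succ hq, evenGF_succ hq]
    ring

theorem tsum_mul_qPochInf {q : ℂ} (hq : ‖q‖ < 1) :
    (∑' Λ : CylindricPartition ![2, 2], q ^ Λ.size) * qPochInf q q = tailSeries q 0 := by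
  have hE := tendsto_qPoch q hq
  have hx : Tendsto (evenGF q) atTop
      (𝓝 ((∑' Λ : CylindricPartition ![2, 2], q ^ Λ.size) * qPochInf q q)) := by
    refine (tendsto_boundedGF hq (fun _ => le_rfl) fun _ => le_rfl).mul ?_
    simp only [eulerProd_eq_qPoch]
    exact hE.comp (tendsto_atTop_mono (fun n => show n ≤ 2 * n by omega) tendsto_id)
  have hy : Tendsto (oddGF q) atTop
      (𝓝 ((∑' Λ : CylindricPartition ![2, 2], q ^ Λ.size) * qPochInf q q)) := by
    refine (tendsto_boundedGF hq Nat.le_succ fun _ => le_rfl).mul ?_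
    simp only [eulerProd_eq_qPoch]
    exact hE.comp (tendsto_atTop_mono (fun n => show n ≤ 2 * n + 1 by omega) tendsto_id)
  have hA := tendsto_tailSeries hq
  have hp : Tendsto (fun m : ℕ => q ^ (2 * m + 1)) atTop (𝓝 0) :=
    (tendsto_pow_atTop_nhds_zero_of_norm_lt_one hq).comp
      (tendsto_atTop_mono (fun n => show n ≤ 2 * n + 1 by omega) tendsto_id)
  -- The second summand of the invariant vanishes in the limit, as `oddGF` and `evenGF` share
  -- theirs.
  have h := (hA.mul hy).add
    (((hp.const_sub 1).mul (hA.comp (tendsto_add_atTop_nat 1))).mul (hy.sub hx))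
  rw [sub_self, mul_zero, add_zero, one_mul] at h
  refine tendsto_nhds_unique h (tendsto_const_nhds.congr fun m => ?_)
  exact (tailSeries_invariant hq m).symm

end CylindricPartition

theorem mainTheorem4 (q : ℂ) (hq : ‖q‖ < 1) :
    Summable (fun n : ℕ+ =>
      2 * q ^ ((n : ℕ) * ((n : ℕ) + 1)) * qPoch (-q ^ 2) (q ^ 2) ((n : ℕ) - 1) /
        (qPoch (q ^ 2) (q ^ 2) n * qPoch (-q) (q ^ 2) n)) ∧
    HasSum (fun Λ : CylindricPartition ![2, 2] => q ^ Λ.size)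
      ((1 + ∑' n : ℕ+,
          2 * q ^ ((n : ℕ) * ((n : ℕ) + 1)) * qPoch (-q ^ 2) (q ^ 2) ((n : ℕ) - 1) /
            (qPoch (q ^ 2) (q ^ 2) n * qPoch (-q) (q ^ 2) n)) *
        (qPochInf (-q) (q ^ 2) / qPochInf q q)) := by
  refine ⟨summable_series_pnat hq, ?_⟩
  have h := CylindricPartition.tsum_mul_qPochInf hq
  rw [tailSeries_zero hq, ← eq_div_iff (qPochInf_ne_zero hq hq), mul_div_assoc] at h
  rw [← h]
  exact (CylindricPartition.summable_norm_pow_size hq).of_norm.hasSum
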